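/- For $n,m\in\mathbb N$ and $1\le p,q\le\infty$, and an $m$-homogeneous polynomial $P(x)=\sum_{|\alpha|=m}a_\alpha x^\alpha$ on $\mathbb R^n$ with real coefficients, let $\|P\|_p=\sup\{|P(x)|:\|x\|_p\le1\}$ and let $|P|_q=\big(\sum_{|\alpha|=m}|a_\alpha|^q\big)^{1/q}$ (the maximum of the $|a_\alpha|$ if $q=\infty$). Let $K_{m,n,q,p}$ be the best (smallest) constant $K$ such that $|P|_q\le K\|P\|_p$ for all such $P$ on $\mathbb R^n$, and write $K_{2,q,p}=K_{2,2,q,p}$. For $m<p\le 2m$ let $C_{\mathbb R,m,p}(n)$ be the best constant in $|P|_{p/(p-m)}\le C\|P\|_p$ for all $m$-homogeneous $P$ on $\mathbb R^n$, and let $C_{\mathbb R,m,p}$ be the best constant that works for all $n$ simultaneously. For $2m\le p\le\infty$ let $D_{\mathbb R,m,p}(n)$ and $D_{\mathbb R,m,p}$ be defined in the same way from $|P|_{2mp/(mp+p-2m)}\le D\|P\|_p$, where the exponent is $2m/(m+1)$ for $p=\infty$. All these best constants are infima in $[0,\infty]$. For $q\ge 1$, $2<p<\infty$ and $\alpha\in[0,1]$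 put $$f_{q,p}(\alpha)=\left[2\left|\frac{2\alpha^p-1}{\alpha^2+(1-\alpha^p)^{2/p}}\right|^q+\left(2\alpha(1-\alpha^p)^{1/p}\,\frac{\alpha^{p-2}+(1-\alpha^p)^{(p-2)/p}}{\alpha^2+(1-\alpha^p)^{2/p}}\right)^q\right]^{1/q},$$ and, for $p=\infty$, take the limiting form $$f_{q,\infty}(\alpha)=\left[2\left(\frac1{1+\alpha^2}\right)^q+\left(\frac{2\alpha}{1+\alpha^2}\right)^q\right]^{1/q}.$$ **Theorem.** (i) For $2<p\le4$, $$C_{\mathbb R,2,p}\ \ge\ C_{\mathbb R,2,p}(2)=K_{2,\frac p{p-2},p}=\max_{\alpha\in[0,1]}f_{\frac p{p-2},p}(\alpha).$$ (ii) For $4\le p\le\infty$, $$D_{\mathbb R,2,p}\ \ge\ D_{\mathbb R,2,p}(2)=K_{2,\frac{4p}{3p-4},p}=\max_{\alpha\in[0,1]}f_{\frac{4p}{3p-4},p}(\alpha),$$ where $\frac{4p}{3p-4}$ is read as $\frac43$ for $p=\infty$. In both parts the maximum is attained. -/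

import Mathlib

open scoped ENNReal

noncomputable section

/-- The polynomial norm `‖P‖_p = sup {|P(x)| : x ∈ ℝⁿ, ‖x‖_p ≤ 1}` of a polynomial on `ℓ_p^n`,
as an element of `[0, ∞]`. -/
def polyNorm {n : ℕ} (p : ℝ≥0∞) (P : MvPolynomial (Fin n) ℝ) : ℝ≥0∞ :=
  ⨆ (x : PiLp p (fun _ : Fin n => ℝ)) (_ : ‖x‖ ≤ 1), ENNReal.ofReal |MvPolynomial.eval x.ofLp P|

/-- The `ℓ_q` norm `|P|_q` of the coefficients of `P`: `(∑ |a_α|^q)^(1/q)` for finite `q`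
(coefficients outside the support vanish and contribute nothing), and `sup |a_α|` for `q = ∞`. -/
def coeffNorm {n : ℕ} (q : ℝ≥0∞) (P : MvPolynomial (Fin n) ℝ) : ℝ≥0∞ :=
  if q = ∞ then ⨆ α : Fin n →₀ ℕ, ENNReal.ofReal |P.coeff α|
  else ENNReal.ofReal ((∑ α ∈ P.support, |P.coeff α| ^ q.toReal) ^ (1 / q.toReal))

/-- `K_{m,n,q,p}`: the best constant `K ∈ [0, ∞]` with `|P|_q ≤ K ‖P‖_p` for all `m`-homogeneous
polynomials `P` on `ℝⁿ`. -/
def equivConst (m n : ℕ) (q p : ℝ≥0∞) : ℝ≥0∞ :=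
  sInf {K : ℝ≥0∞ | ∀ P : MvPolynomial (Fin n) ℝ, P.IsHomogeneous m →
    coeffNorm q P ≤ K * polyNorm p P}

/-- The Hardy-Littlewood exponent `p / (p - m)`, used for `m < p ≤ 2m`. -/
def hlExpC (m : ℕ) (p : ℝ≥0∞) : ℝ≥0∞ :=
  ENNReal.ofReal (p.toReal / (p.toReal - m))

/-- The Hardy-Littlewood exponent `2mp / (mp + p - 2m)`, used for `2m ≤ p ≤ ∞`, with the value
`2m / (m + 1)` for `p = ∞`. -/
def hlExpD (m : ℕ) (p : ℝ≥0∞) : ℝ≥0∞ :=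
  if p = ∞ then ENNReal.ofReal (2 * m / (m + 1))
  else ENNReal.ofReal (2 * m * p.toReal / (m * p.toReal + p.toReal - 2 * m))

/-- `C_{ℝ,m,p}`: the best constant `C ∈ [0, ∞]`, independent of `n`, with
`|P|_{p/(p-m)} ≤ C ‖P‖_p` for all `n` and all `m`-homogeneous `P` on `ℝⁿ`. -/
def hlC (m : ℕ) (p : ℝ≥0∞) : ℝ≥0∞ :=
  sInf {C : ℝ≥0∞ | ∀ (n : ℕ) (P : MvPolynomial (Fin n) ℝ), P.IsHomogeneous m →
    coeffNorm (hlExpC m p) P ≤ C * polyNorm p P}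

/-- `C_{ℝ,m,p}(n)`: the best constant in the same inequality for fixed `n`. -/
def hlCn (m : ℕ) (p : ℝ≥0∞) (n : ℕ) : ℝ≥0∞ :=
  sInf {C : ℝ≥0∞ | ∀ P : MvPolynomial (Fin n) ℝ, P.IsHomogeneous m →
    coeffNorm (hlExpC m p) P ≤ C * polyNorm p P}

/-- `D_{ℝ,m,p}`: the best constant `D ∈ [0, ∞]`, independent of `n`, with
`|P|_{2mp/(mp+p-2m)} ≤ D ‖P‖_p` for all `n` and all `m`-homogeneous `P` on `ℝⁿ`. -/
def hlD (m : ℕ) (p : ℝ≥0∞) : ℝ≥0∞ :=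
  sInf {D : ℝ≥0∞ | ∀ (n : ℕ) (P : MvPolynomial (Fin n) ℝ), P.IsHomogeneous m →
    coeffNorm (hlExpD m p) P ≤ D * polyNorm p P}

/-- `D_{ℝ,m,p}(n)`: the best constant in the same inequality for fixed `n`. -/
def hlDn (m : ℕ) (p : ℝ≥0∞) (n : ℕ) : ℝ≥0∞ :=
  sInf {D : ℝ≥0∞ | ∀ P : MvPolynomial (Fin n) ℝ, P.IsHomogeneous m →
    coeffNorm (hlExpD m p) P ≤ D * polyNorm p P}

/-- The function `f_{q,p}` on `[0, 1]`, for finite `p`. -/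
def hlFun (q p α : ℝ) : ℝ :=
  (2 * |(2 * α ^ p - 1) / (α ^ (2 : ℝ) + (1 - α ^ p) ^ (2 / p))| ^ q
    + (2 * α * (1 - α ^ p) ^ (1 / p)
        * ((α ^ (p - 2) + (1 - α ^ p) ^ ((p - 2) / p))
          / (α ^ (2 : ℝ) + (1 - α ^ p) ^ (2 / p)))) ^ q) ^ (1 / q)

/-- The limiting form of `f_{q,p}` for `p = ∞`: for `0 ≤ α < 1` one has, as `p → ∞`, `α ^ p → 0`,
`α ^ (p - 2) → 0` and `(1 - α ^ p) ^ (c / p), (1 - α ^ p) ^ ((p - 2) / p) → 1`. The closed form is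
extended continuously to `α = 1`. -/
def hlFunTop (q α : ℝ) : ℝ :=
  (2 * (1 / (α ^ (2 : ℝ) + 1)) ^ q + (2 * α / (α ^ (2 : ℝ) + 1)) ^ q) ^ (1 / q)

end

/-!
Write a binary quadratic form as `P = a x² + b y² + c x y`. Suppose `P` has norm one on `ℓ_p²`,
`2 < p < ∞`. By compactness `|P|` takes the value one on the unit sphere; after sign changes, which
affect neither norm, `P(α, β) = 1` with `α, β ≥ 0` and `α^p + β^p = 1`. The Lagrange condition
(`lagrange_of_attained`) fixes the gradient of `P` at this point, so that, when `α β > 0`,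
`P = D + t (β x - α y)²` with `D = α^(p-2) x² + β^(p-2) y²` and a real parameter `t`.
The bound `P(-α, β) ≤ 1` gives `t ≤ 0`, and the bound `P(-β, α) ≥ -1` limits `t` from below. The
two ends of the interval are `D` and the form `E_α = A (x² - y²) + C x y` whose coefficients occur
in `f_{q,p}(α)`. By convexity of the `ℓ_q` norm, `|P|_q ≤ max (|D|_q) (|E_α|_q)`
(`powSum_le_max_two`). Here `|E_α|_q = f_{q,p}(α)`, and `|D|_q ≤ 1 ≤ f_{q,p}(1)` because
`q ≥ p / (p - 2)` for the exponents in question; the degenerate case `α β = 0` gives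
`|P|_q ≤ 2^(1/q) = f_{q,p}(1)`.

Conversely `E_α` has norm at most one: it is at most `D`, which is at most one on the ball by
Young's inequality, and a quarter turn maps `E_α` to `-E_α` (`extremal_form_abs_le_one`). So the
best constant is the maximum of the continuous function `f_{q,p}`.

For `p = ∞` the same argument runs along a side of the square, with `x²` in the place of `D`
(`box_powSum_le_max_of_lt_one`); the corner, where only one-sided derivatives are available, is
treated separately (`box_powSum_le_max_corner`).
-/

/-! ### Convexity of the coefficient norm -/

/-- The sum of the `q`-th powers of the coefficients of `a x² + b y² + c x y`. -/
noncomputable def powSum (q a b c : ℝ) : ℝ := |a| ^ q + |b| ^ q + |c| ^ q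

lemma powSum_nonneg (q a b c : ℝ) : 0 ≤ powSum q a b c := by
  unfold powSum; positivity

lemma abs_rpow_convex {q s : ℝ} (hq : 1 ≤ q) (hs : 0 ≤ s) (hs1 : s ≤ 1) (u v : ℝ) :
    |(1 - s) * u + s * v| ^ q ≤ (1 - s) * |u| ^ q + s * |v| ^ q := by
  have h1 : |(1 - s) * u + s * v| ≤ (1 - s) * |u| + s * |v| := by
    refine (abs_add_le _ _).trans_eq ?_
    rw [abs_mul, abs_mul, abs_of_nonneg hs, abs_of_nonneg (sub_nonneg.2 hs1)]
  refine (Real.rpow_le_rpow (abs_nonneg _) h1 (by linarith)).trans ?_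
  have := (convexOn_rpow hq).2 (abs_nonneg u) (abs_nonneg v) (sub_nonneg.2 hs1) hs (by ring)
  simpa [smul_eq_mul] using this

lemma powSum_convex {q s : ℝ} (hq : 1 ≤ q) (hs : 0 ≤ s) (hs1 : s ≤ 1) (a b c a' b' c' : ℝ) :
    powSum q ((1 - s) * a + s * a') ((1 - s) * b + s * b') ((1 - s) * c + s * c')
      ≤ (1 - s) * powSum q a b c + s * powSum q a' b' c' := by
  unfold powSum
  have h1 := abs_rpow_convex hq hs hs1 a a'
  have h2 := abs_rpow_convex hq hs hs1 b b'
  have h3 := abs_rpow_convex hq hs hs1 c c'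
  linarith

lemma powSum_convex_le_max {q s : ℝ} (hq : 1 ≤ q) (hs : 0 ≤ s) (hs1 : s ≤ 1)
    (a b c a' b' c' : ℝ) :
    powSum q ((1 - s) * a + s * a') ((1 - s) * b + s * b') ((1 - s) * c + s * c')
      ≤ max (powSum q a b c) (powSum q a' b' c') := by
  refine (powSum_convex hq hs hs1 a b c a' b' c').trans ?_
  have h1 := mul_le_mul_of_nonneg_left (le_max_left (powSum q a b c) (powSum q a' b' c'))
    (sub_nonneg.2 hs1)
  have h2 := mul_le_mul_of_nonneg_left (le_max_right (powSum q a b c) (powSum q a' b' c')) hs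
  linarith

lemma powSum_mul {q M : ℝ} (hq : 0 < q) (hM : 0 ≤ M) (a b c : ℝ) :
    powSum q (M * a) (M * b) (M * c) ^ (1 / q) = M * powSum q a b c ^ (1 / q) := by
  have : powSum q (M * a) (M * b) (M * c) = M ^ q * powSum q a b c := by
    unfold powSum
    simp only [abs_mul, abs_of_nonneg hM, Real.mul_rpow hM (abs_nonneg _)]
    ring
  rw [this, Real.mul_rpow (by positivity) (powSum_nonneg _ _ _ _), ← Real.rpow_mul hM,
    mul_one_div_cancel hq.ne', Real.rpow_one]

/-! ### Binary quadratic forms as polynomials -/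

/-- The binary quadratic form `a x² + b y² + c x y` as a polynomial. -/
noncomputable def quadPoly (a b c : ℝ) : MvPolynomial (Fin 2) ℝ :=
  MvPolynomial.monomial (Finsupp.single 0 2) a + MvPolynomial.monomial (Finsupp.single 1 2) b
    + MvPolynomial.monomial (Finsupp.single 0 1 + Finsupp.single 1 1) c

lemma quadPoly_isHomogeneous (a b c : ℝ) : (quadPoly a b c).IsHomogeneous 2 := by
  unfold quadPoly
  refine ((MvPolynomial.isHomogeneous_monomial _ ?_).add
    (MvPolynomial.isHomogeneous_monomial _ ?_)).add (MvPolynomial.isHomogeneous_monomial _ ?_) <;>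
  simp [map_add]

lemma eval_quadPoly (a b c : ℝ) (x : Fin 2 → ℝ) :
    MvPolynomial.eval x (quadPoly a b c) = a * x 0 ^ 2 + b * x 1 ^ 2 + c * (x 0 * x 1) := by
  simp [quadPoly, MvPolynomial.eval_monomial, Finsupp.prod_add_index', pow_add]

lemma finTwo_single_zero_ne_single_one :
    (Finsupp.single 0 2 : Fin 2 →₀ ℕ) ≠ Finsupp.single 1 2 := by
  intro h; simpa using DFunLike.congr_fun h 0

lemma finTwo_single_zero_ne_mixed :
    (Finsupp.single 0 2 : Fin 2 →₀ ℕ) ≠ Finsupp.single 0 1 + Finsupp.single 1 1 := by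
  intro h; simpa using DFunLike.congr_fun h 0

lemma finTwo_single_one_ne_mixed :
    (Finsupp.single 1 2 : Fin 2 →₀ ℕ) ≠ Finsupp.single 0 1 + Finsupp.single 1 1 := by
  intro h; simpa using DFunLike.congr_fun h 0

lemma exists_eq_quadPoly {P : MvPolynomial (Fin 2) ℝ} (hP : P.IsHomogeneous 2) :
    ∃ a b c, P = quadPoly a b c := by
  refine ⟨P.coeff (Finsupp.single 0 2), P.coeff (Finsupp.single 1 2),
    P.coeff (Finsupp.single 0 1 + Finsupp.single 1 1), ?_⟩
  ext d
  by_cases hd : d.degree = 2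
  · have hd' : d 0 + d 1 = 2 := by
      rw [Finsupp.degree_eq_sum] at hd; simpa using hd
    have : d = Finsupp.single 0 2 ∨ d = Finsupp.single 1 2
        ∨ d = Finsupp.single 0 1 + Finsupp.single 1 1 := by
      have h0 : d 0 = 0 ∨ d 0 = 1 ∨ d 0 = 2 := by omega
      rcases h0 with h | h | h
      · right; left; ext i; fin_cases i
        · simpa using h
        · simp; omega
      · right; right; ext i; fin_cases i
        · simpa using h
        · simp; omega
      · left; ext i; fin_cases i
        · simpa using h
        · simp; omega
    rcases this with rfl | rfl | rfl
    · simp [quadPoly, MvPolynomial.coeff_monomial, finTwo_single_zero_ne_single_one.symm,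
        finTwo_single_zero_ne_mixed.symm]
    · simp [quadPoly, MvPolynomial.coeff_monomial, finTwo_single_zero_ne_single_one,
        finTwo_single_one_ne_mixed.symm]
    · simp [quadPoly, MvPolynomial.coeff_monomial, finTwo_single_zero_ne_mixed,
        finTwo_single_one_ne_mixed]
  · rw [hP.coeff_eq_zero hd, (quadPoly_isHomogeneous _ _ _).coeff_eq_zero hd]

lemma coeffNorm_quadPoly {q : ℝ} (hq : 0 < q) (a b c : ℝ) :
    coeffNorm (ENNReal.ofReal q) (quadPoly a b c)
      = ENNReal.ofReal (powSum q a b c ^ (1 / q)) := by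
  classical
  rw [coeffNorm, if_neg ENNReal.ofReal_ne_top, ENNReal.toReal_ofReal hq.le]
  congr 2
  let T : Finset (Fin 2 →₀ ℕ) :=
    {Finsupp.single 0 2, Finsupp.single 1 2, Finsupp.single 0 1 + Finsupp.single 1 1}
  have hsub : (quadPoly a b c).support ⊆ T := by
    intro d hd
    by_contra hT
    simp only [T, Finset.mem_insert, Finset.mem_singleton, not_or] at hT
    apply MvPolynomial.mem_support_iff.1 hd
    simp [quadPoly, MvPolynomial.coeff_monomial, Ne.symm hT.1, Ne.symm hT.2.1, Ne.symm hT.2.2]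
  rw [Finset.sum_subset hsub (fun d _ hd => by
    rw [MvPolynomial.notMem_support_iff.1 hd, abs_zero, Real.zero_rpow hq.ne'])]
  have n1 := finTwo_single_zero_ne_single_one
  have n2 := finTwo_single_zero_ne_mixed
  have n3 := finTwo_single_one_ne_mixed
  rw [Finset.sum_insert (by simp [n1, n2]), Finset.sum_insert (by simp [n3]),
    Finset.sum_singleton]
  simp [quadPoly, MvPolynomial.coeff_monomial, n1, n2, n3, n1.symm, n2.symm, n3.symm, powSum,
    add_assoc]

/-! ### Reduction to forms attaining their norm -/

/-- A nonzero form attains its norm at some point of the ball, so after scaling it is enough to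
bound the coefficients of forms of norm one that take the value `±1`. -/
lemma coeffNorm_le_mul_polyNorm {p : ℝ≥0∞} [Fact (1 ≤ p)] {q M : ℝ} (hq : 1 ≤ q)
    (hM : ∀ a b c : ℝ,
      (∀ x : PiLp p (fun _ : Fin 2 => ℝ), ‖x‖ ≤ 1 →
        |a * x 0 ^ 2 + b * x 1 ^ 2 + c * (x 0 * x 1)| ≤ 1) →
      (∃ x : PiLp p (fun _ : Fin 2 => ℝ), ‖x‖ ≤ 1 ∧
        |a * x 0 ^ 2 + b * x 1 ^ 2 + c * (x 0 * x 1)| = 1) →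
      powSum q a b c ^ (1 / q) ≤ M)
    {P : MvPolynomial (Fin 2) ℝ} (hP : P.IsHomogeneous 2) :
    coeffNorm (ENNReal.ofReal q) P ≤ ENNReal.ofReal M * polyNorm p P := by
  obtain ⟨a, b, c, rfl⟩ := exists_eq_quadPoly hP
  have hq0 : 0 < q := by linarith
  rw [coeffNorm_quadPoly hq0]
  let f : PiLp p (fun _ : Fin 2 => ℝ) → ℝ := fun x =>
    |a * x 0 ^ 2 + b * x 1 ^ 2 + c * (x 0 * x 1)|
  have hf : Continuous f := by
    have h0 : Continuous fun x : PiLp p (fun _ : Fin 2 => ℝ) => x 0 :=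
      PiLp.continuous_apply p _ 0
    have h1 : Continuous fun x : PiLp p (fun _ : Fin 2 => ℝ) => x 1 :=
      PiLp.continuous_apply p _ 1
    fun_prop
  obtain ⟨v, hv, hmax⟩ := (isCompact_closedBall (0 : PiLp p (fun _ : Fin 2 => ℝ)) 1).exists_isMaxOn
    ⟨0, by simp⟩ hf.continuousOn
  have hv1 : ‖v‖ ≤ 1 := by simpa using hv
  have hle : ∀ x : PiLp p (fun _ : Fin 2 => ℝ), ‖x‖ ≤ 1 → f x ≤ f v := fun x hx =>
    hmax (by simpa using hx)
  have hN : polyNorm p (quadPoly a b c) = ENNReal.ofReal (f v) := by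
    apply le_antisymm
    · refine iSup₂_le fun x hx => ENNReal.ofReal_le_ofReal ?_
      rw [eval_quadPoly]; exact hle x hx
    · refine le_iSup₂_of_le v hv1 (ENNReal.ofReal_le_ofReal ?_)
      rw [eval_quadPoly]
  rw [hN]
  have hfv : 0 ≤ f v := abs_nonneg _
  rcases hfv.eq_or_lt with h0 | hpos
  · have hz : ∀ x y : ℝ, a * x ^ 2 + b * y ^ 2 + c * (x * y) = 0 := by
      intro x y
      let w : PiLp p (fun _ : Fin 2 => ℝ) := WithLp.toLp p ![x, y]
      have hr : 0 < ‖w‖ + 1 := by positivity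
      have hw := hle ((‖w‖ + 1)⁻¹ • w) (by
        rw [norm_smul, norm_inv, Real.norm_of_nonneg hr.le, inv_mul_le_iff₀ hr]; linarith)
      rw [← h0] at hw
      have hw0 := abs_nonpos_iff.1 hw
      have e : a * x ^ 2 + b * y ^ 2 + c * (x * y)
          = (‖w‖ + 1) ^ 2 * (a * (((‖w‖ + 1)⁻¹ • w) 0) ^ 2 + b * (((‖w‖ + 1)⁻¹ • w) 1) ^ 2
            + c * ((((‖w‖ + 1)⁻¹ • w) 0) * (((‖w‖ + 1)⁻¹ • w) 1))) := by
        simp only [PiLp.smul_apply, smul_eq_mul, w, Matrix.cons_val_zero, Matrix.cons_val_one]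
        field_simp
      rw [e, hw0, mul_zero]
    have ha : a = 0 := by simpa using hz 1 0
    have hb : b = 0 := by simpa using hz 0 1
    have hc : c = 0 := by simpa [ha, hb] using hz 1 1
    subst ha hb hc
    simp [powSum, Real.zero_rpow hq0.ne', Real.zero_rpow (inv_pos.2 hq0).ne']
  · have key := hM (a / f v) (b / f v) (c / f v)
    have e : ∀ x : PiLp p (fun _ : Fin 2 => ℝ),
        |a / f v * x 0 ^ 2 + b / f v * x 1 ^ 2 + c / f v * (x 0 * x 1)| = f x / f v := by
      intro x
      rw [show a / f v * x 0 ^ 2 + b / f v * x 1 ^ 2 + c / f v * (x 0 * x 1)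
        = (a * x 0 ^ 2 + b * x 1 ^ 2 + c * (x 0 * x 1)) / f v by ring, abs_div,
        abs_of_pos hpos]
    have key := key (fun x hx => by rw [e, div_le_one hpos]; exact hle x hx)
      ⟨v, hv1, by rw [e, div_self hpos.ne']⟩
    rw [mul_comm, ← ENNReal.ofReal_mul hfv]
    apply ENNReal.ofReal_le_ofReal
    have h := powSum_mul hq0 hfv (a / f v) (b / f v) (c / f v)
    simp only [mul_div_cancel₀ _ hpos.ne'] at h
    rw [h]
    exact mul_le_mul_of_nonneg_left key hfv

/-- If the forms `A α x² + B α y² + C α x y`, for `α ∈ [0, 1]`, have norm at most one, and the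
coefficients of every form of norm one are dominated by those of one of them, then the best
constant is the maximum over `α`. -/
lemma isGreatest_equivConst {p : ℝ≥0∞} [Fact (1 ≤ p)] {q : ℝ} (hq : 1 ≤ q) {F A B C : ℝ → ℝ}
    (hF : ContinuousOn F (Set.Icc 0 1))
    (hFS : ∀ α ∈ Set.Icc (0 : ℝ) 1, F α = powSum q (A α) (B α) (C α) ^ (1 / q))
    (hball : ∀ α ∈ Set.Icc (0 : ℝ) 1, ∀ x : PiLp p (fun _ : Fin 2 => ℝ), ‖x‖ ≤ 1 →
      |A α * x 0 ^ 2 + B α * x 1 ^ 2 + C α * (x 0 * x 1)| ≤ 1)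
    (hdom : ∀ a b c : ℝ,
      (∀ x : PiLp p (fun _ : Fin 2 => ℝ), ‖x‖ ≤ 1 →
        |a * x 0 ^ 2 + b * x 1 ^ 2 + c * (x 0 * x 1)| ≤ 1) →
      (∃ x : PiLp p (fun _ : Fin 2 => ℝ), ‖x‖ ≤ 1 ∧
        |a * x 0 ^ 2 + b * x 1 ^ 2 + c * (x 0 * x 1)| = 1) →
      ∃ α ∈ Set.Icc (0 : ℝ) 1, powSum q a b c ≤ powSum q (A α) (B α) (C α)) :
    IsGreatest ((fun α => ENNReal.ofReal (F α)) '' Set.Icc 0 1)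
      (equivConst 2 2 (ENNReal.ofReal q) p) := by
  have hq0 : 0 < q := by linarith
  obtain ⟨α₀, hα₀, hmax⟩ := isCompact_Icc.exists_isMaxOn ⟨0, by simp⟩ hF
  have lower : ∀ α ∈ Set.Icc (0 : ℝ) 1,
      ENNReal.ofReal (F α) ≤ equivConst 2 2 (ENNReal.ofReal q) p := by
    intro α hα
    refine le_sInf fun K hK => ?_
    have h := hK (quadPoly (A α) (B α) (C α)) (quadPoly_isHomogeneous _ _ _)
    rw [coeffNorm_quadPoly hq0, ← hFS α hα] at h
    refine h.trans (mul_le_of_le_one_right' ?_)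
    refine iSup₂_le fun x hx => ?_
    rw [eval_quadPoly, ENNReal.ofReal_le_one]
    exact hball α hα x hx
  have upper : equivConst 2 2 (ENNReal.ofReal q) p ≤ ENNReal.ofReal (F α₀) := by
    refine sInf_le fun P hP => coeffNorm_le_mul_polyNorm hq (fun a b c h1 h2 => ?_) hP
    obtain ⟨α, hα, h⟩ := hdom a b c h1 h2
    refine (Real.rpow_le_rpow (powSum_nonneg _ _ _ _) h (by positivity)).trans ?_
    rw [← hFS α hα]
    exact hmax hα
  refine ⟨⟨α₀, hα₀, le_antisymm (lower α₀ hα₀) upper⟩, ?_⟩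
  rintro _ ⟨α, hα, rfl⟩
  exact lower α hα

/-! ### Extremal forms on `ℓ_p²` for finite `p` -/

/-- The coefficient of `x²`, and minus that of `y²`, in the extremal form attached to the point
`(α, β)` of the unit sphere of `ℓ_p²`. -/
noncomputable def extDiag (p α β : ℝ) : ℝ := (α ^ p - β ^ p) / (α ^ 2 + β ^ 2)

/-- The coefficient of `x y` in the extremal form attached to the point `(α, β)` of the unit sphere
of `ℓ_p²`. -/
noncomputable def extMixed (p α β : ℝ) : ℝ :=
  2 * α * β * ((α ^ (p - 2) + β ^ (p - 2)) / (α ^ 2 + β ^ 2))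

lemma sq_add_sq_pos_of_rpow {p α β : ℝ} (hp : 2 < p) (h : α ^ p + β ^ p = 1) :
    0 < α ^ 2 + β ^ 2 := by
  rcases eq_or_ne α 0 with rfl | hα
  · rcases eq_or_ne β 0 with rfl | hβ
    · rw [Real.zero_rpow (by linarith)] at h; norm_num at h
    · positivity
  · positivity

lemma rpow_sub_two_mul_sq {p α : ℝ} (hp : 2 < p) (hα : 0 ≤ α) :
    α ^ (p - 2) * α ^ 2 = α ^ p := by
  rw [← Real.rpow_natCast, ← Real.rpow_add_of_nonneg hα (by linarith) (by norm_num)]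
  norm_num

/-- Young's inequality: the diagonal form `α^(p-2) x² + β^(p-2) y²` has norm at most one. -/
lemma diagonal_form_le_one {p α β x y : ℝ} (hp : 2 < p) (hα : 0 ≤ α) (hβ : 0 ≤ β)
    (h : α ^ p + β ^ p = 1) (hxy : |x| ^ p + |y| ^ p ≤ 1) :
    α ^ (p - 2) * x ^ 2 + β ^ (p - 2) * y ^ 2 ≤ 1 := by
  have hp0 : 0 < p := by linarith
  have key : ∀ u z : ℝ, 0 ≤ u → u ^ (p - 2) * z ^ 2 ≤ (p - 2) / p * u ^ p + 2 / p * |z| ^ p := by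
    intro u z hu
    have := Real.geom_mean_le_arith_mean2_weighted (w₁ := (p - 2) / p) (w₂ := 2 / p)
      (p₁ := u ^ p) (p₂ := |z| ^ p) (div_nonneg (by linarith) hp0.le) (by positivity)
      (by positivity) (by positivity) (by field_simp; ring)
    rw [← Real.rpow_mul hu, ← Real.rpow_mul (abs_nonneg z), mul_div_cancel₀ _ hp0.ne',
      mul_div_cancel₀ _ hp0.ne', Real.rpow_two, sq_abs] at this
    exact this
  have h1 := key α x hα
  have h2 := key β y hβ
  have h3 : (p - 2) / p * α ^ p + 2 / p * |x| ^ p + ((p - 2) / p * β ^ p + 2 / p * |y| ^ p)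
      = (p - 2) / p + 2 / p * (|x| ^ p + |y| ^ p) := by
    linear_combination (p - 2) / p * h
  have h4 : 2 / p * (|x| ^ p + |y| ^ p) ≤ 2 / p := mul_le_of_le_one_right (by positivity) hxy
  have h5 : (p - 2) / p + 2 / p = 1 := by field_simp; ring
  linarith

/-- The extremal form lies below the diagonal one by a multiple of the square `(β x - α y)²`. -/
lemma extremal_form_eq {p α β : ℝ} (hp : 2 < p) (hα : 0 ≤ α) (hβ : 0 ≤ β)
    (h : α ^ p + β ^ p = 1) (x y : ℝ) :
    extDiag p α β * x ^ 2 + -extDiag p α β * y ^ 2 + extMixed p α β * (x * y)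
      = α ^ (p - 2) * x ^ 2 + β ^ (p - 2) * y ^ 2
        - (α ^ (p - 2) + β ^ (p - 2)) / (α ^ 2 + β ^ 2) * (β * x - α * y) ^ 2 := by
  have hpos := (sq_add_sq_pos_of_rpow hp h).ne'
  unfold extDiag extMixed
  rw [← rpow_sub_two_mul_sq hp hα, ← rpow_sub_two_mul_sq hp hβ]
  field_simp
  ring

lemma extremal_form_abs_le_one {p α β x y : ℝ} (hp : 2 < p) (hα : 0 ≤ α) (hβ : 0 ≤ β)
    (h : α ^ p + β ^ p = 1) (hxy : |x| ^ p + |y| ^ p ≤ 1) :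
    |extDiag p α β * x ^ 2 + -extDiag p α β * y ^ 2 + extMixed p α β * (x * y)| ≤ 1 := by
  have upper : ∀ x y : ℝ, |x| ^ p + |y| ^ p ≤ 1 →
      extDiag p α β * x ^ 2 + -extDiag p α β * y ^ 2 + extMixed p α β * (x * y) ≤ 1 := by
    intro x y hxy
    rw [extremal_form_eq hp hα hβ h]
    have h1 := diagonal_form_le_one hp hα hβ h hxy
    have h2 : 0 ≤ (α ^ (p - 2) + β ^ (p - 2)) / (α ^ 2 + β ^ 2) * (β * x - α * y) ^ 2 := by
      positivity
    linarith
  -- A quarter turn changes the sign of the extremal form.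
  have h2 := upper y (-x) (by rw [abs_neg]; linarith)
  exact abs_le.2 ⟨by nlinarith [h2], upper x y hxy⟩

/-- The Lagrange condition at a point where a form of norm one takes the value one. -/
lemma lagrange_of_attained {p a b c α β : ℝ} (hp : 2 < p) (hα : 0 ≤ α) (hβ : 0 ≤ β)
    (h : α ^ p + β ^ p = 1)
    (hle : ∀ x y : ℝ, a * x ^ 2 + b * y ^ 2 + c * (x * y) ≤ (|x| ^ p + |y| ^ p) ^ (2 / p))
    (hv : a * α ^ 2 + b * β ^ 2 + c * (α * β) = 1) :
    2 * a * α + c * β = 2 * (α ^ (p - 2) * α) := by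
  have hp0 : 0 < p := by linarith
  have d1 : HasDerivAt (fun x : ℝ => |x| ^ p + |β| ^ p) (p * |α| ^ (p - 2) * α) α :=
    (hasDerivAt_abs_rpow α (by linarith)).add_const _
  have e1 : |α| ^ p + |β| ^ p = 1 := by rw [abs_of_nonneg hα, abs_of_nonneg hβ, h]
  have d2 := d1.rpow_const (p := 2 / p) (Or.inl (by rw [e1]; exact one_ne_zero))
  have d3 : HasDerivAt (fun x : ℝ => a * x ^ 2 + b * β ^ 2 + c * (x * β))
      (a * (2 * α) + c * β) α := by
    have := (((hasDerivAt_pow 2 α).const_mul a).add_const (b * β ^ 2)).add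
      (((hasDerivAt_id α).mul_const β).const_mul c)
    simpa [Function.comp_def, Pi.add_def] using this
  have hmin : IsLocalMin (fun x : ℝ => (|x| ^ p + |β| ^ p) ^ (2 / p)
      - (a * x ^ 2 + b * β ^ 2 + c * (x * β))) α := by
    refine Filter.Eventually.of_forall fun x => ?_
    simp only [e1, hv, Real.one_rpow, sub_self, sub_nonneg]
    exact hle x β
  have := hmin.hasDerivAt_eq_zero (d2.sub d3)
  rw [e1, Real.one_rpow, abs_of_nonneg hα] at this
  have e2 : p * α ^ (p - 2) * α * (2 / p) * 1 = 2 * (α ^ (p - 2) * α) := by field_simp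
  linarith

lemma powSum_diagonal_le_one {p q α β : ℝ} (hp : 2 < p) (hpq : p / (p - 2) ≤ q) (hα : 0 ≤ α)
    (hβ : 0 ≤ β) (h : α ^ p + β ^ p = 1) : powSum q (α ^ (p - 2)) (β ^ (p - 2)) 0 ≤ 1 := by
  have hp2 : 0 < p - 2 := by linarith
  have hp0 : 0 < p := by linarith
  have hq : 0 < q := lt_of_lt_of_le (by positivity) hpq
  have hpq' : p ≤ (p - 2) * q := by rwa [div_le_iff₀' hp2] at hpq
  have key : ∀ u : ℝ, 0 ≤ u → u ^ p ≤ 1 → |u ^ (p - 2)| ^ q ≤ u ^ p := by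
    intro u hu h1
    rw [abs_of_nonneg (by positivity), ← Real.rpow_mul hu]
    rcases hu.eq_or_lt with rfl | hu
    · rw [Real.zero_rpow hp0.ne', Real.zero_rpow (by positivity)]
    · refine Real.rpow_le_rpow_of_exponent_ge hu ?_ hpq'
      by_contra! hlt
      exact absurd h1 (not_le.2 (Real.one_lt_rpow hlt hp0))
  have h1 : 0 ≤ α ^ p := by positivity
  have h2 : 0 ≤ β ^ p := by positivity
  have k1 := key α hα (by linarith)
  have k2 := key β hβ (by linarith)
  rw [powSum, abs_zero, Real.zero_rpow hq.ne']
  linarith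

/-! ### Domination by extremal forms for finite `p` -/

lemma powSum_le_two {q a b : ℝ} (hq : 0 < q) (ha : |a| ≤ 1) (hb : |b| ≤ 1) :
    powSum q a b 0 ≤ 2 := by
  have h1 := Real.rpow_le_one (abs_nonneg a) ha hq.le
  have h2 := Real.rpow_le_one (abs_nonneg b) hb hq.le
  rw [powSum, abs_zero, Real.zero_rpow hq.ne']
  linarith

/-- A form of norm one that takes the value one at a point `(α, β)` of the first quadrant is
a convex combination of the diagonal and the extremal form attached to that point. If `α β = 0`, it
is a diagonal form with coefficients in `[-1, 1]`. -/
lemma powSum_le_max_two {p q a b c α β : ℝ} (hp : 2 < p) (hq : 1 ≤ q) (hpq : p / (p - 2) ≤ q)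
    (hα : 0 ≤ α) (hβ : 0 ≤ β) (h : α ^ p + β ^ p = 1)
    (hle : ∀ x y : ℝ, |a * x ^ 2 + b * y ^ 2 + c * (x * y)| ≤ (|x| ^ p + |y| ^ p) ^ (2 / p))
    (hv : a * α ^ 2 + b * β ^ 2 + c * (α * β) = 1) :
    powSum q a b c
      ≤ max 2 (powSum q (extDiag p α β) (-extDiag p α β) (extMixed p α β)) := by
  have hp0 : 0 < p := by linarith
  have hq0 : 0 < q := by linarith
  have L1 := lagrange_of_attained hp hα hβ h (fun x y => (le_abs_self _).trans (hle x y)) hv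
  have L2 := lagrange_of_attained (a := b) (b := a) (c := c) hp hβ hα (by linarith)
    (fun x y => by
      have := (le_abs_self _).trans (hle y x)
      rw [add_comm (|x| ^ p)]
      linarith) (by linarith)
  have hroot : ∀ u : ℝ, 0 ≤ u → u ^ p = 1 → u = 1 := fun u hu hu1 =>
    (Real.rpow_left_inj hu zero_le_one hp0.ne').1 (by rw [hu1, Real.one_rpow])
  have ha : |a| ≤ 1 := by simpa [Real.zero_rpow hp0.ne'] using hle 1 0
  have hb : |b| ≤ 1 := by simpa [Real.zero_rpow hp0.ne'] using hle 0 1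
  rcases hα.eq_or_lt with rfl | hα'
  · have hβ1 : β = 1 := hroot β hβ (by simpa [Real.zero_rpow hp0.ne'] using h)
    have hc : c = 0 := by simpa [hβ1] using L1
    rw [hc]
    exact le_max_of_le_left (powSum_le_two hq0 ha hb)
  rcases hβ.eq_or_lt with rfl | hβ'
  · have hα1 : α = 1 := hroot α hα (by simpa [Real.zero_rpow hp0.ne'] using h)
    have hc : c = 0 := by simpa [hα1] using L2
    rw [hc]
    exact le_max_of_le_left (powSum_le_two hq0 ha hb)
  have hu : 0 < α ^ (p - 2) := by positivity
  have hw : 0 < β ^ (p - 2) := by positivity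
  have hdiag := powSum_diagonal_le_one hp hpq hα hβ h
  have hsum : α ^ (p - 2) * α ^ 2 + β ^ (p - 2) * β ^ 2 = 1 := by
    rw [rpow_sub_two_mul_sq hp hα, rpow_sub_two_mul_sq hp hβ, h]
  have hA : extDiag p α β
      = (α ^ (p - 2) * α ^ 2 - β ^ (p - 2) * β ^ 2) / (α ^ 2 + β ^ 2) := by
    rw [extDiag, rpow_sub_two_mul_sq hp hα, rpow_sub_two_mul_sq hp hβ]
  have hC : extMixed p α β
      = 2 * α * β * ((α ^ (p - 2) + β ^ (p - 2)) / (α ^ 2 + β ^ 2)) := rfl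
  -- The form also obeys the bounds at the mirror image and at the quarter turn of `(α, β)`.
  have hmirror : a * α ^ 2 + b * β ^ 2 - c * (α * β) ≤ 1 := by
    have := (le_abs_self _).trans (hle (-α) β)
    rw [abs_neg, abs_of_nonneg hα, abs_of_nonneg hβ, h, Real.one_rpow] at this
    linarith
  have hturn : -1 ≤ a * β ^ 2 + b * α ^ 2 - c * (α * β) := by
    have := (neg_le_abs _).trans (hle (-β) α)
    rw [abs_neg, abs_of_nonneg hα, abs_of_nonneg hβ, add_comm (β ^ p), h, Real.one_rpow] at this
    linarith
  rw [hA, hC]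
  generalize α ^ (p - 2) = u at *
  generalize β ^ (p - 2) = w at *
  have hc0 : 0 ≤ c := by
    have : 0 ≤ c * (α * β) := by linarith
    exact nonneg_of_mul_nonneg_left this (by positivity)
  have ea : a = u - c * β / (2 * α) := by
    field_simp
    linarith
  have eb : b = w - c * α / (2 * β) := by
    field_simp
    linarith
  have hcle : c * (α ^ 2 + β ^ 2) ≤ 2 * α * β * (u + w) := by
    have e : a * β ^ 2 + b * α ^ 2 - c * (α * β)
        = u * β ^ 2 + w * α ^ 2 - c * (α ^ 2 + β ^ 2) ^ 2 / (2 * α * β) := by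
      rw [ea, eb]
      field_simp
      ring
    have h1 : c * (α ^ 2 + β ^ 2) ^ 2 / (2 * α * β) ≤ (u + w) * (α ^ 2 + β ^ 2) := by
      linarith
    rw [div_le_iff₀ (by positivity)] at h1
    refine le_of_mul_le_mul_right ?_ (show 0 < α ^ 2 + β ^ 2 by positivity)
    linarith
  -- The weight of the extremal form is read off from the mixed coefficient.
  obtain ⟨s, hs⟩ : ∃ s, s = c * (α ^ 2 + β ^ 2) / (2 * α * β * (u + w)) := ⟨_, rfl⟩
  have hs0 : 0 ≤ s := by rw [hs]; positivity
  have hs1 : s ≤ 1 := by rw [hs, div_le_one (by positivity)]; exact hcle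
  have hconv := powSum_convex_le_max hq hs0 hs1 u w 0
    ((u * α ^ 2 - w * β ^ 2) / (α ^ 2 + β ^ 2)) (-((u * α ^ 2 - w * β ^ 2) / (α ^ 2 + β ^ 2)))
    (2 * α * β * ((u + w) / (α ^ 2 + β ^ 2)))
  have e1 : (1 - s) * u + s * ((u * α ^ 2 - w * β ^ 2) / (α ^ 2 + β ^ 2)) = a := by
    rw [ea, hs]
    field_simp
    ring
  have e2 : (1 - s) * w + s * -((u * α ^ 2 - w * β ^ 2) / (α ^ 2 + β ^ 2)) = b := by
    rw [eb, hs]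
    field_simp
    ring
  have e3 : (1 - s) * 0 + s * (2 * α * β * ((u + w) / (α ^ 2 + β ^ 2))) = c := by
    rw [hs]
    field_simp
    ring
  rw [e1, e2, e3] at hconv
  exact hconv.trans (max_le_max (hdiag.trans one_le_two) le_rfl)

lemma exists_sign_mul_abs (x y : ℝ) : ∃ δ : ℝ, (δ = 1 ∨ δ = -1) ∧ x * y = δ * (|x| * |y|) := by
  rw [← abs_mul]
  rcases abs_choice (x * y) with h | h
  · exact ⟨1, Or.inl rfl, by rw [h, one_mul]⟩
  · exact ⟨-1, Or.inr rfl, by rw [h]; ring⟩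

lemma powSum_mul_signs (q a b c : ℝ) {ε δ : ℝ} (hε : ε = 1 ∨ ε = -1) (hδ : δ = 1 ∨ δ = -1) :
    powSum q (ε * a) (ε * b) (ε * (δ * c)) = powSum q a b c := by
  rcases hε with rfl | rfl <;> rcases hδ with rfl | rfl <;> simp [powSum]

lemma abs_form_mul_signs (a b c x y : ℝ) {ε δ : ℝ} (hε : ε = 1 ∨ ε = -1)
    (hδ : δ = 1 ∨ δ = -1) :
    |ε * a * x ^ 2 + ε * b * y ^ 2 + ε * (δ * c) * (x * y)|
      = |a * x ^ 2 + b * (δ * y) ^ 2 + c * (x * (δ * y))| := by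
  have e : ε * a * x ^ 2 + ε * b * y ^ 2 + ε * (δ * c) * (x * y)
      = ε * (a * x ^ 2 + b * (δ * y) ^ 2 + c * (x * (δ * y))) := by
    rcases hδ with rfl | rfl <;> ring
  rw [e, abs_mul]
  rcases hε with rfl | rfl <;> simp

/-- Reflections of the plane and a change of sign of the form move a point where the norm one is
attained into the first quadrant, with the value there equal to one. -/
lemma form_at_abs {a b c x y : ℝ} (hv : |a * x ^ 2 + b * y ^ 2 + c * (x * y)| = 1) :
    ∃ ε δ : ℝ, (ε = 1 ∨ ε = -1) ∧ (δ = 1 ∨ δ = -1) ∧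
      ε * a * |x| ^ 2 + ε * b * |y| ^ 2 + ε * (δ * c) * (|x| * |y|) = 1 := by
  obtain ⟨δ, hδ, hxy⟩ := exists_sign_mul_abs x y
  rw [hxy] at hv
  rcases (abs_eq zero_le_one).1 hv with h | h
  · exact ⟨1, δ, Or.inl rfl, hδ, by rw [sq_abs, sq_abs]; linarith⟩
  · exact ⟨-1, δ, Or.inr rfl, hδ, by rw [sq_abs, sq_abs]; linarith⟩

lemma abs_sign {δ : ℝ} (hδ : δ = 1 ∨ δ = -1) : |δ| = 1 := by
  rcases hδ with rfl | rfl <;> simp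

lemma abs_form_le_of_ball {p a b c : ℝ} (hp : 2 < p)
    (hball : ∀ x y : ℝ, |x| ^ p + |y| ^ p ≤ 1 → |a * x ^ 2 + b * y ^ 2 + c * (x * y)| ≤ 1)
    (x y : ℝ) :
    |a * x ^ 2 + b * y ^ 2 + c * (x * y)| ≤ (|x| ^ p + |y| ^ p) ^ (2 / p) := by
  have hp0 : 0 < p := by linarith
  have hx : 0 ≤ |x| ^ p := by positivity
  have hy : 0 ≤ |y| ^ p := by positivity
  obtain ⟨N, hN⟩ : ∃ N, N = |x| ^ p + |y| ^ p := ⟨_, rfl⟩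
  have hN0 : 0 ≤ N := by linarith
  rw [← hN]
  rcases hN0.eq_or_lt with h0 | hpos
  · have hx0 : x = 0 := by
      have : |x| ^ p = 0 := by linarith
      simpa using (Real.rpow_eq_zero (abs_nonneg x) hp0.ne').1 this
    have hy0 : y = 0 := by
      have : |y| ^ p = 0 := by linarith
      simpa using (Real.rpow_eq_zero (abs_nonneg y) hp0.ne').1 this
    rw [hx0, hy0]
    simpa using Real.rpow_nonneg hN0 (2 / p)
  · have hr : 0 < N ^ (1 / p) := by positivity
    have hrp : (N ^ (1 / p)) ^ p = N := by
      rw [← Real.rpow_mul hN0, one_div_mul_cancel hp0.ne', Real.rpow_one]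
    have hr2 : N ^ (2 / p) = (N ^ (1 / p)) ^ 2 := by
      rw [← Real.rpow_natCast, ← Real.rpow_mul hN0]
      congr 1
      push_cast
      ring
    have key := hball (x / N ^ (1 / p)) (y / N ^ (1 / p)) (by
      rw [abs_div, abs_div, abs_of_pos hr, Real.div_rpow (abs_nonneg _) hr.le,
        Real.div_rpow (abs_nonneg _) hr.le, hrp, ← add_div, ← hN, div_self hpos.ne'])
    have e : a * (x / N ^ (1 / p)) ^ 2 + b * (y / N ^ (1 / p)) ^ 2
        + c * (x / N ^ (1 / p) * (y / N ^ (1 / p)))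
        = (a * x ^ 2 + b * y ^ 2 + c * (x * y)) / (N ^ (1 / p)) ^ 2 := by
      field_simp
    rw [e, abs_div, abs_of_pos (pow_pos hr 2), div_le_one (pow_pos hr 2)] at key
    rw [hr2]
    exact key

/-- Every form of norm one on `ℓ_p²` is dominated, in `ℓ_q` norm of the coefficients, by an extremal
form. -/
lemma exists_powSum_le_extremal {p q a b c x y : ℝ} (hp : 2 < p) (hq : 1 ≤ q)
    (hpq : p / (p - 2) ≤ q)
    (hball : ∀ x y : ℝ, |x| ^ p + |y| ^ p ≤ 1 → |a * x ^ 2 + b * y ^ 2 + c * (x * y)| ≤ 1)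
    (hxy : |x| ^ p + |y| ^ p ≤ 1) (hv : |a * x ^ 2 + b * y ^ 2 + c * (x * y)| = 1) :
    ∃ α ∈ Set.Icc (0 : ℝ) 1, powSum q a b c
      ≤ powSum q (extDiag p α ((1 - α ^ p) ^ (1 / p))) (-extDiag p α ((1 - α ^ p) ^ (1 / p)))
          (extMixed p α ((1 - α ^ p) ^ (1 / p))) := by
  have hp0 : 0 < p := by linarith
  have hle := abs_form_le_of_ball hp hball
  have hx : 0 ≤ |x| ^ p := by positivity
  have hy : 0 ≤ |y| ^ p := by positivity
  have hsum : |x| ^ p + |y| ^ p = 1 := by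
    refine hxy.antisymm ?_
    by_contra! hlt
    have h1 := Real.rpow_lt_one (by positivity) hlt (show 0 < 2 / p by positivity)
    have h2 := hle x y
    rw [hv] at h2
    linarith
  obtain ⟨ε, δ, hε, hδ, h1⟩ := form_at_abs hv
  have hmax := powSum_le_max_two (a := ε * a) (b := ε * b) (c := ε * (δ * c)) hp hq hpq
    (abs_nonneg x) (abs_nonneg y) hsum (fun X Y => by
      rw [abs_form_mul_signs a b c X Y hε hδ]
      simpa [abs_mul, abs_sign hδ] using hle X (δ * Y)) h1
  rw [powSum_mul_signs q a b c hε hδ] at hmax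
  rcases le_max_iff.1 hmax with h | h
  · -- At `α = 1` the extremal form is `x² - y²`, whose power sum is `2`.
    refine ⟨1, by simp, h.trans_eq ?_⟩
    have h0 : (0 : ℝ) ^ p⁻¹ = 0 := Real.zero_rpow (inv_pos.2 hp0).ne'
    have hq0 : q ≠ 0 := by linarith
    simp [powSum, extDiag, extMixed, h0, Real.zero_rpow hp0.ne', Real.zero_rpow hq0]
    norm_num
  · have hx1 : |x| ≤ 1 := by
      by_contra! hlt
      have := Real.one_lt_rpow hlt hp0
      linarith
    have hyx : (1 - |x| ^ p) ^ (1 / p) = |y| := by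
      rw [show 1 - |x| ^ p = |y| ^ p by linarith, ← Real.rpow_mul (abs_nonneg y),
        mul_one_div_cancel hp0.ne', Real.rpow_one]
    exact ⟨|x|, ⟨abs_nonneg x, hx1⟩, by rw [hyx]; exact h⟩

/-! ### The best constant for finite `p` -/

lemma one_sub_rpow_mem_sphere {p α : ℝ} (hp : 0 < p) (hα : α ∈ Set.Icc (0 : ℝ) 1) :
    0 ≤ (1 - α ^ p) ^ (1 / p) ∧ α ^ p + ((1 - α ^ p) ^ (1 / p)) ^ p = 1 := by
  have h : 0 ≤ 1 - α ^ p := sub_nonneg.2 (Real.rpow_le_one hα.1 hα.2 hp.le)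
  refine ⟨by positivity, ?_⟩
  rw [← Real.rpow_mul h, one_div_mul_cancel hp.ne', Real.rpow_one]
  ring

lemma hlFun_eq_powSum {p q α : ℝ} (hp : 2 < p) (hα : α ∈ Set.Icc (0 : ℝ) 1) :
    hlFun q p α
      = powSum q (extDiag p α ((1 - α ^ p) ^ (1 / p))) (-extDiag p α ((1 - α ^ p) ^ (1 / p)))
          (extMixed p α ((1 - α ^ p) ^ (1 / p))) ^ (1 / q) := by
  have hp0 : 0 < p := by linarith
  have h : 0 ≤ 1 - α ^ p := sub_nonneg.2 (Real.rpow_le_one hα.1 hα.2 hp0.le)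
  obtain ⟨hβ, hs⟩ := one_sub_rpow_mem_sphere hp0 hα
  have e1 : (1 - α ^ p) ^ (2 / p) = ((1 - α ^ p) ^ (1 / p)) ^ 2 := by
    rw [← Real.rpow_natCast, ← Real.rpow_mul h]
    congr 1
    push_cast
    ring
  have e2 : (1 - α ^ p) ^ ((p - 2) / p) = ((1 - α ^ p) ^ (1 / p)) ^ (p - 2) := by
    rw [← Real.rpow_mul h]
    congr 1
    ring
  have e3 : 2 * α ^ p - 1 = α ^ p - ((1 - α ^ p) ^ (1 / p)) ^ p := by linarith
  have hα0 := hα.1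
  have hC : 0 ≤ extMixed p α ((1 - α ^ p) ^ (1 / p)) := by
    unfold extMixed
    positivity
  rw [hlFun, powSum, abs_neg, abs_of_nonneg hC, e1, e2, e3, Real.rpow_two]
  unfold extDiag extMixed
  ring_nf

lemma continuousOn_hlFun {p q : ℝ} (hp : 2 < p) (hq : 1 ≤ q) :
    ContinuousOn (hlFun q p) (Set.Icc 0 1) := by
  have hp0 : 0 < p := by linarith
  have hq0 : 0 < q := by linarith
  have c1 : Continuous fun α : ℝ => α ^ p := Real.continuous_rpow_const hp0.le
  have c2 : Continuous fun α : ℝ => α ^ (p - 2) := Real.continuous_rpow_const (by linarith)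
  have c3 : Continuous fun α : ℝ => α ^ (2 : ℝ) := Real.continuous_rpow_const (by norm_num)
  have c4 : ∀ r : ℝ, 0 ≤ r → Continuous fun α : ℝ => (1 - α ^ p) ^ r := fun r hr =>
    (continuous_const.sub c1).rpow_const fun _ => Or.inr hr
  have c5 := c4 (2 / p) (by positivity)
  have c6 := c4 (1 / p) (by positivity)
  have c7 := c4 ((p - 2) / p) (div_nonneg (by linarith) hp0.le)
  have hden : ∀ α ∈ Set.Icc (0 : ℝ) 1, α ^ (2 : ℝ) + (1 - α ^ p) ^ (2 / p) ≠ 0 := by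
    intro α hα
    have h : 0 ≤ 1 - α ^ p := sub_nonneg.2 (Real.rpow_le_one hα.1 hα.2 hp0.le)
    have h2 : 0 ≤ (1 - α ^ p) ^ (2 / p) := by positivity
    rcases hα.1.eq_or_lt with rfl | hpos
    · simp [Real.zero_rpow hp0.ne']
    · positivity
  have d1 : ContinuousOn (fun α : ℝ =>
      |(2 * α ^ p - 1) / (α ^ (2 : ℝ) + (1 - α ^ p) ^ (2 / p))|) (Set.Icc 0 1) :=
    (ContinuousOn.div (by fun_prop) (by fun_prop) hden).abs
  have d2 : ContinuousOn (fun α : ℝ => 2 * α * (1 - α ^ p) ^ (1 / p)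
      * ((α ^ (p - 2) + (1 - α ^ p) ^ ((p - 2) / p))
        / (α ^ (2 : ℝ) + (1 - α ^ p) ^ (2 / p)))) (Set.Icc 0 1) :=
    ContinuousOn.mul (by fun_prop) (ContinuousOn.div (by fun_prop) (by fun_prop) hden)
  exact (((d1.rpow_const fun _ _ => Or.inr hq0.le).const_mul 2).add
    (d2.rpow_const fun _ _ => Or.inr hq0.le)).rpow_const fun _ _ => Or.inr (by positivity)

lemma piLp_two_norm_le_one_iff {p : ℝ} (hp : 0 < p)
    (x : PiLp (ENNReal.ofReal p) (fun _ : Fin 2 => ℝ)) :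
    ‖x‖ ≤ 1 ↔ |x 0| ^ p + |x 1| ^ p ≤ 1 := by
  have h : 0 < (ENNReal.ofReal p).toReal := by rwa [ENNReal.toReal_ofReal hp.le]
  rw [PiLp.norm_eq_sum h, ENNReal.toReal_ofReal hp.le, Fin.sum_univ_two, Real.norm_eq_abs,
    Real.norm_eq_abs]
  have hmono := Real.rpow_le_rpow_iff (x := |x 0| ^ p + |x 1| ^ p) (y := 1) (z := 1 / p)
    (by positivity) zero_le_one (by positivity)
  rwa [Real.one_rpow] at hmono

lemma isGreatest_hlFun {p q : ℝ} (hp : 2 < p) (hq : 1 ≤ q) (hpq : p / (p - 2) ≤ q) :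
    IsGreatest ((fun α => ENNReal.ofReal (hlFun q p α)) '' Set.Icc 0 1)
      (equivConst 2 2 (ENNReal.ofReal q) (ENNReal.ofReal p)) := by
  have hp0 : 0 < p := by linarith
  have : Fact (1 ≤ ENNReal.ofReal p) := ⟨by rw [ENNReal.one_le_ofReal]; linarith⟩
  refine isGreatest_equivConst hq (continuousOn_hlFun hp hq) (fun α hα => hlFun_eq_powSum hp hα)
    ?_ ?_
  · intro α hα x hx
    obtain ⟨hβ, hs⟩ := one_sub_rpow_mem_sphere hp0 hα
    exact extremal_form_abs_le_one hp hα.1 hβ hs ((piLp_two_norm_le_one_iff hp0 x).1 hx)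
  · rintro a b c hball ⟨x, hx, hv⟩
    refine exists_powSum_le_extremal hp hq hpq (fun X Y hXY => ?_)
      ((piLp_two_norm_le_one_iff hp0 x).1 hx) hv
    simpa using hball (WithLp.toLp _ ![X, Y])
      ((piLp_two_norm_le_one_iff hp0 _).2 (by simpa using hXY))

/-! ### Extremal forms on `ℓ_∞²` -/

lemma box_extremal_form_abs_le_one {α x y : ℝ} (hx : |x| ≤ 1) (hy : |y| ≤ 1) :
    |1 / (α ^ 2 + 1) * x ^ 2 + -(1 / (α ^ 2 + 1)) * y ^ 2 + 2 * α / (α ^ 2 + 1) * (x * y)| ≤ 1 := by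
  have upper : ∀ x y : ℝ, |x| ≤ 1 →
      1 / (α ^ 2 + 1) * x ^ 2 + -(1 / (α ^ 2 + 1)) * y ^ 2 + 2 * α / (α ^ 2 + 1) * (x * y)
        ≤ 1 := by
    intro x y hx
    have e : 1 / (α ^ 2 + 1) * x ^ 2 + -(1 / (α ^ 2 + 1)) * y ^ 2
        + 2 * α / (α ^ 2 + 1) * (x * y) = x ^ 2 - (α * x - y) ^ 2 / (α ^ 2 + 1) := by
      field_simp
      ring
    have h1 : 0 ≤ (α * x - y) ^ 2 / (α ^ 2 + 1) := by positivity
    have h2 := (sq_le_one_iff_abs_le_one x).2 hx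
    rw [e]
    linarith
  have h2 := upper y (-x) hy
  exact abs_le.2 ⟨by linarith, upper x y hx⟩

/-- A form of norm one on `ℓ_∞²` that takes the value one at `(1, y)` with `y < 1`: the derivative
along the side of the square vanishes there, and the form is a convex combination of `x²` and an
extremal form. -/
lemma box_powSum_le_max_of_lt_one {q a b c y : ℝ} (hq : 1 ≤ q)
    (hball : ∀ x y : ℝ, |x| ≤ 1 → |y| ≤ 1 → |a * x ^ 2 + b * y ^ 2 + c * (x * y)| ≤ 1)
    (hy : 0 ≤ y) (hy1 : y < 1) (hv : a + b * y ^ 2 + c * y = 1) :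
    powSum q a b c
      ≤ max 2 (powSum q (1 / (y ^ 2 + 1)) (-(1 / (y ^ 2 + 1))) (2 * y / (y ^ 2 + 1))) := by
  have hq0 : 0 < q := by linarith
  have hc : c = -(2 * b * y) := by
    have hd : HasDerivAt (fun z : ℝ => a + b * z ^ 2 + c * z) (b * (2 * y) + c) y := by
      have := (((hasDerivAt_pow 2 y).const_mul b).const_add a).add
        ((hasDerivAt_id y).const_mul c)
      simpa [Function.comp_def, Pi.add_def] using this
    have hmax : IsLocalMax (fun z : ℝ => a + b * z ^ 2 + c * z) y := by
      filter_upwards [Ioo_mem_nhds (show -1 < y by linarith) hy1] with z hz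
      have h := (le_abs_self _).trans (hball 1 z (by simp) (abs_le.2 ⟨hz.1.le, hz.2.le⟩))
      simp only [hv]
      linarith
    linarith [hmax.hasDerivAt_eq_zero hd]
  have ha : a = 1 + b * y ^ 2 := by
    rw [hc] at hv
    linarith
  have hb : |b| ≤ 1 := by simpa using hball 0 1 (by simp) (by simp)
  rcases hy.eq_or_lt with rfl | hy0
  · have ha1 : a = 1 := by simpa using ha
    have hc0 : c = 0 := by simpa using hc
    rw [ha1, hc0]
    exact le_max_of_le_left (powSum_le_two hq0 (by simp) hb)
  have hyabs : |y| ≤ 1 := abs_le.2 ⟨by linarith, hy1.le⟩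
  have hb0 : b ≤ 0 := by
    have h := (le_abs_self _).trans (hball (-1) y (by simp) hyabs)
    have h' : b * y ^ 2 ≤ 0 := by
      rw [hc, ha] at h
      linarith
    exact nonpos_of_mul_nonpos_left h' (by positivity)
  have hb1 : -1 ≤ b * (y ^ 2 + 1) := by
    have h := (neg_le_abs _).trans (hball (-y) 1 (by rwa [abs_neg]) (by simp))
    rw [hc, ha] at h
    have h' : -1 * (y ^ 2 + 1) ≤ b * (y ^ 2 + 1) * (y ^ 2 + 1) := by linarith
    exact le_of_mul_le_mul_right h' (by positivity)
  have hconv := powSum_convex_le_max (s := -(b * (y ^ 2 + 1))) hq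
    (neg_nonneg.2 (mul_nonpos_of_nonpos_of_nonneg hb0 (by positivity))) (by linarith) 1 0 0
    (1 / (y ^ 2 + 1)) (-(1 / (y ^ 2 + 1))) (2 * y / (y ^ 2 + 1))
  have e1 : (1 - -(b * (y ^ 2 + 1))) * 1 + -(b * (y ^ 2 + 1)) * (1 / (y ^ 2 + 1)) = a := by
    rw [ha]
    field_simp
    ring
  have e2 : (1 - -(b * (y ^ 2 + 1))) * 0 + -(b * (y ^ 2 + 1)) * -(1 / (y ^ 2 + 1)) = b := by
    field_simp
    ring
  have e3 : (1 - -(b * (y ^ 2 + 1))) * 0 + -(b * (y ^ 2 + 1)) * (2 * y / (y ^ 2 + 1)) = c := by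
    rw [hc]
    field_simp
    ring
  rw [e1, e2, e3] at hconv
  exact hconv.trans (max_le_max (powSum_le_two hq0 (by simp) (by simp)) le_rfl)

lemma nonneg_of_corner_bound {b d : ℝ} (hb : |b| ≤ 1) (hd : -2 ≤ d)
    (h : ∀ t : ℝ, 0 ≤ t → t ≤ 1 → b * t ^ 2 ≤ d * t) : 0 ≤ d := by
  by_contra! hneg
  have := h (-d / 2) (by linarith) (by linarith)
  nlinarith [(abs_le.1 hb).1, mul_self_pos.2 hneg.ne]

/-- A form of norm one on `ℓ_∞²` that takes the value one at the corner `(1, 1)`: it lies in the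
convex hull of `x²`, `y²` and the two forms `±(x² - y²) / 2 + x y`. -/
lemma box_powSum_le_max_corner {q a b c : ℝ} (hq : 1 ≤ q)
    (hball : ∀ x y : ℝ, |x| ≤ 1 → |y| ≤ 1 → |a * x ^ 2 + b * y ^ 2 + c * (x * y)| ≤ 1)
    (hv : a + b + c = 1) :
    powSum q a b c ≤ max 2 (powSum q (1 / 2) (-(1 / 2)) 1) := by
  have hq0 : 0 < q := by linarith
  have ha : |a| ≤ 1 := by simpa using hball 1 0 (by simp) (by simp)
  have hb : |b| ≤ 1 := by simpa using hball 0 1 (by simp) (by simp)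
  obtain ⟨hm1, hm2⟩ := abs_le.1 (hball 1 (-1) (by simp) (by simp))
  have hc0 : 0 ≤ c := by linarith
  have hs0 : 0 ≤ a + b := by linarith
  have hs1 : a + b ≤ 1 := by linarith
  -- The two one-sided derivatives at the corner.
  have h1 : 0 ≤ 2 * b + c := by
    refine nonneg_of_corner_bound hb (by linarith [(abs_le.1 hb).1]) fun t ht ht1 => ?_
    have := (le_abs_self _).trans
      (hball 1 (1 - t) (by simp) (abs_le.2 ⟨by linarith, by linarith⟩))
    linarith
  have h2 : 0 ≤ 2 * a + c := by
    refine nonneg_of_corner_bound ha (by linarith [(abs_le.1 ha).1]) fun t ht ht1 => ?_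
    have := (le_abs_self _).trans
      (hball (1 - t) 1 (abs_le.2 ⟨by linarith, by linarith⟩) (by simp))
    linarith
  have hd : |(a - b) / 2| ≤ 1 / 2 := abs_le.2 ⟨by linarith, by linarith⟩
  have hconv := powSum_convex_le_max hq hs0 hs1 ((a - b) / 2) (-((a - b) / 2)) 1
    ((1 + (a - b)) / 2) ((1 - (a - b)) / 2) 0
  have e1 : (1 - (a + b)) * ((a - b) / 2) + (a + b) * ((1 + (a - b)) / 2) = a := by ring
  have e2 : (1 - (a + b)) * -((a - b) / 2) + (a + b) * ((1 - (a - b)) / 2) = b := by ring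
  have e3 : (1 - (a + b)) * 1 + (a + b) * 0 = c := by linarith
  rw [e1, e2, e3, max_comm] at hconv
  refine hconv.trans (max_le_max (powSum_le_two hq0 ?_ ?_) ?_)
  · exact abs_le.2 ⟨by linarith, by linarith⟩
  · exact abs_le.2 ⟨by linarith, by linarith⟩
  · have h := Real.rpow_le_rpow (abs_nonneg _) hd hq0.le
    have e : |(1 / 2 : ℝ)| = 1 / 2 := abs_of_pos (by norm_num)
    simp only [powSum, abs_neg, e]
    linarith

lemma powSum_swap (q a b c : ℝ) : powSum q a b c = powSum q b a c := by
  unfold powSum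
  ring

/-- Every form of norm one on `ℓ_∞²` is dominated, in `ℓ_q` norm of the coefficients, by an extremal
form. -/
lemma exists_powSum_le_box_extremal {q a b c x y : ℝ} (hq : 1 ≤ q)
    (hball : ∀ x y : ℝ, |x| ≤ 1 → |y| ≤ 1 → |a * x ^ 2 + b * y ^ 2 + c * (x * y)| ≤ 1)
    (hx : |x| ≤ 1) (hy : |y| ≤ 1) (hv : |a * x ^ 2 + b * y ^ 2 + c * (x * y)| = 1) :
    ∃ α ∈ Set.Icc (0 : ℝ) 1, powSum q a b c
      ≤ powSum q (1 / (α ^ 2 + 1)) (-(1 / (α ^ 2 + 1))) (2 * α / (α ^ 2 + 1)) := by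
  have hq0 : 0 < q := by linarith
  wlog hyx : |y| ≤ |x| generalizing a b x y
  · obtain ⟨α, hα, h⟩ := this (a := b) (b := a) (x := y) (y := x)
      (fun X Y hX hY => by
        have := hball Y X hY hX
        rwa [add_comm (a * Y ^ 2), mul_comm Y X] at this)
      hy hx (by rwa [add_comm (b * y ^ 2), mul_comm y x]) (le_of_not_ge hyx)
    exact ⟨α, hα, (powSum_swap q a b c).trans_le h⟩
  -- By homogeneity the value one is not attained inside the square.
  have hx1 : |x| = 1 := by
    have hpos : 0 < |x| := by
      rw [abs_pos]
      rintro rfl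
      have hy0 : y = 0 := by simpa using hyx
      simp [hy0] at hv
    have h := hball (x / |x|) (y / |x|) (by rw [abs_div, abs_abs, div_self hpos.ne'])
      (by rwa [abs_div, abs_abs, div_le_one hpos])
    have e : a * (x / |x|) ^ 2 + b * (y / |x|) ^ 2 + c * (x / |x| * (y / |x|))
        = (a * x ^ 2 + b * y ^ 2 + c * (x * y)) / |x| ^ 2 := by
      field_simp
    rw [e, abs_div, hv, abs_of_pos (pow_pos hpos 2), div_le_one (pow_pos hpos 2)] at h
    exact hx.antisymm ((one_le_sq_iff₀ hpos.le).1 h)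
  obtain ⟨ε, δ, hε, hδ, h1⟩ := form_at_abs hv
  rw [hx1, one_pow, mul_one, one_mul] at h1
  have hball' : ∀ X Y : ℝ, |X| ≤ 1 → |Y| ≤ 1 →
      |ε * a * X ^ 2 + ε * b * Y ^ 2 + ε * (δ * c) * (X * Y)| ≤ 1 := by
    intro X Y hX hY
    rw [abs_form_mul_signs a b c X Y hε hδ]
    exact hball X (δ * Y) hX (by rwa [abs_mul, abs_sign hδ, one_mul])
  have hmax : powSum q a b c ≤ max 2 (powSum q (1 / (|y| ^ 2 + 1)) (-(1 / (|y| ^ 2 + 1)))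
      (2 * |y| / (|y| ^ 2 + 1))) := by
    rw [← powSum_mul_signs q a b c hε hδ]
    rcases hy.lt_or_eq with hlt | heq
    · exact box_powSum_le_max_of_lt_one hq hball' (abs_nonneg y) hlt h1
    · rw [heq] at h1 ⊢
      have := box_powSum_le_max_corner hq hball' (by linarith)
      norm_num at this ⊢
      exact this
  rcases le_max_iff.1 hmax with h | h
  · refine ⟨0, by simp, h.trans_eq ?_⟩
    simp [powSum, Real.zero_rpow hq0.ne']
    norm_num
  · exact ⟨|y|, ⟨abs_nonneg y, hy⟩, h⟩

lemma hlFunTop_eq_powSum {q α : ℝ} (hα : 0 ≤ α) :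
    hlFunTop q α
      = powSum q (1 / (α ^ 2 + 1)) (-(1 / (α ^ 2 + 1))) (2 * α / (α ^ 2 + 1)) ^ (1 / q) := by
  have h1 : 0 ≤ 1 / (α ^ 2 + 1) := by positivity
  have h2 : 0 ≤ 2 * α / (α ^ 2 + 1) := by positivity
  rw [hlFunTop, powSum, abs_neg, abs_of_nonneg h1, abs_of_nonneg h2, Real.rpow_two]
  ring_nf

lemma continuous_hlFunTop {q : ℝ} (hq : 0 < q) : Continuous (hlFunTop q) := by
  have hden : ∀ α : ℝ, α ^ (2 : ℝ) + 1 ≠ 0 := by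
    intro α
    rw [Real.rpow_two]
    positivity
  have c3 : Continuous fun α : ℝ => α ^ (2 : ℝ) := Real.continuous_rpow_const (by norm_num)
  have d1 : Continuous fun α : ℝ => 1 / (α ^ (2 : ℝ) + 1) :=
    continuous_const.div (by fun_prop) hden
  have d2 : Continuous fun α : ℝ => 2 * α / (α ^ (2 : ℝ) + 1) :=
    Continuous.div (by fun_prop) (by fun_prop) hden
  exact (((d1.rpow_const fun _ => Or.inr hq.le).const_mul 2).add
    (d2.rpow_const fun _ => Or.inr hq.le)).rpow_const fun _ => Or.inr (by positivity)

lemma piLp_top_two_norm_le_one_iff (x : PiLp ∞ (fun _ : Fin 2 => ℝ)) :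
    ‖x‖ ≤ 1 ↔ |x 0| ≤ 1 ∧ |x 1| ≤ 1 := by
  constructor
  · exact fun h => ⟨(PiLp.norm_apply_le x 0).trans h, (PiLp.norm_apply_le x 1).trans h⟩
  · rintro ⟨h0, h1⟩
    rw [PiLp.norm_eq_ciSup]
    refine ciSup_le fun i => ?_
    fin_cases i
    · exact h0
    · exact h1

lemma isGreatest_hlFunTop {q : ℝ} (hq : 1 ≤ q) :
    IsGreatest ((fun α => ENNReal.ofReal (hlFunTop q α)) '' Set.Icc 0 1)
      (equivConst 2 2 (ENNReal.ofReal q) ∞) := by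
  refine isGreatest_equivConst hq (continuous_hlFunTop (by linarith)).continuousOn
    (fun α hα => hlFunTop_eq_powSum hα.1) ?_ ?_
  · intro α hα x hx
    obtain ⟨h0, h1⟩ := (piLp_top_two_norm_le_one_iff x).1 hx
    exact box_extremal_form_abs_le_one h0 h1
  · rintro a b c hball ⟨x, hx, hv⟩
    obtain ⟨h0, h1⟩ := (piLp_top_two_norm_le_one_iff x).1 hx
    refine exists_powSum_le_box_extremal hq (fun X Y hX hY => ?_) h0 h1 hv
    simpa using hball (WithLp.toLp _ ![X, Y])
      ((piLp_top_two_norm_le_one_iff _).2 (by simpa using ⟨hX, hY⟩))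

/-! ### Hardy-Littlewood constants -/

lemma hlCn_le_hlC (m : ℕ) (p : ℝ≥0∞) (n : ℕ) : hlCn m p n ≤ hlC m p :=
  sInf_le_sInf fun _ hC => hC n

lemma hlDn_le_hlD (m : ℕ) (p : ℝ≥0∞) (n : ℕ) : hlDn m p n ≤ hlD m p :=
  sInf_le_sInf fun _ hD => hD n

lemma hlExpC_two_ofReal {p : ℝ} (hp : 0 ≤ p) :
    hlExpC 2 (ENNReal.ofReal p) = ENNReal.ofReal (p / (p - 2)) := by
  rw [hlExpC, ENNReal.toReal_ofReal hp, Nat.cast_ofNat]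

lemma hlExpD_two_ofReal {p : ℝ} (hp : 0 ≤ p) :
    hlExpD 2 (ENNReal.ofReal p) = ENNReal.ofReal (4 * p / (3 * p - 4)) := by
  rw [hlExpD, if_neg ENNReal.ofReal_ne_top, ENNReal.toReal_ofReal hp, Nat.cast_ofNat]
  congr 2 <;> ring

lemma hlExpD_two_top : hlExpD 2 ∞ = ENNReal.ofReal (4 / 3) := by
  rw [hlExpD, if_pos rfl]
  norm_num

theorem theorem4p1 :
    (∀ p : ℝ, 2 < p → p ≤ 4 →
      hlC 2 (ENNReal.ofReal p) ≥ hlCn 2 (ENNReal.ofReal p) 2 ∧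
      hlCn 2 (ENNReal.ofReal p) 2
        = equivConst 2 2 (ENNReal.ofReal (p / (p - 2))) (ENNReal.ofReal p) ∧
      IsGreatest ((fun α : ℝ => ENNReal.ofReal (hlFun (p / (p - 2)) p α)) '' Set.Icc 0 1)
        (equivConst 2 2 (ENNReal.ofReal (p / (p - 2))) (ENNReal.ofReal p))) ∧
    (∀ p : ℝ, 4 ≤ p →
      hlD 2 (ENNReal.ofReal p) ≥ hlDn 2 (ENNReal.ofReal p) 2 ∧
      hlDn 2 (ENNReal.ofReal p) 2
        = equivConst 2 2 (ENNReal.ofReal (4 * p / (3 * p - 4))) (ENNReal.ofReal p) ∧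
      IsGreatest
        ((fun α : ℝ => ENNReal.ofReal (hlFun (4 * p / (3 * p - 4)) p α)) '' Set.Icc 0 1)
        (equivConst 2 2 (ENNReal.ofReal (4 * p / (3 * p - 4))) (ENNReal.ofReal p))) ∧
    (hlD 2 ∞ ≥ hlDn 2 ∞ 2 ∧
      hlDn 2 ∞ 2 = equivConst 2 2 (ENNReal.ofReal (4 / 3)) ∞ ∧
      IsGreatest ((fun α : ℝ => ENNReal.ofReal (hlFunTop (4 / 3) α)) '' Set.Icc 0 1)
        (equivConst 2 2 (ENNReal.ofReal (4 / 3)) ∞)) := by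
  refine ⟨fun p hp2 hp4 => ⟨hlCn_le_hlC _ _ _, ?_, ?_⟩,
    fun p hp4 => ⟨hlDn_le_hlD _ _ _, ?_, ?_⟩, hlDn_le_hlD _ _ _, ?_, ?_⟩
  · rw [← hlExpC_two_ofReal (by linarith)]
    rfl
  · refine isGreatest_hlFun hp2 ?_ le_rfl
    rw [one_le_div (by linarith)]
    linarith
  · rw [← hlExpD_two_ofReal (by linarith)]
    rfl
  · refine isGreatest_hlFun (by linarith) ?_ ?_
    · rw [one_le_div (by linarith)]
      linarith
    · -- This is `4 p - 8 ≥ 3 p - 4`, that is `p ≥ 4`.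
      rw [div_le_div_iff₀ (by linarith) (by linarith)]
      nlinarith
  · rw [← hlExpD_two_top]
    rfl
  · exact isGreatest_hlFunTop (by norm_num)
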